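/- Let $a<b$ be real, $m\ge 1$ an integer, $\rho>0$, $\tau>0$, $\lambda>0$, and let $\gamma\in\mathbb{R}$ satisfy $\lambda a+\gamma\ge 0$. For a continuous $f:[a,b]\to\mathbb{R}$, a subinterval $[c,d]$ and $n\ge1$ put $$\mathrm{Trap}(f,c,d,n)=\frac{d-c}{2n}\Big(f(c)+f(d)+2\sum_{i=1}^{n-1}f\big(c+\tfrac{i(d-c)}{n}\big)\Big).$$ For an integer $k\ge 2$, the procedure $\mathrm{AdapTrap}_{\rho,m,k}(f,c,d,\tau)$ computes $Q_1=\mathrm{Trap}(f,c,d,m)$ and $Q_2=\mathrm{Trap}(f,c,d,2m)$. If $|Q_2-Q_1|<\tau$ it returns $Q_2$; otherwise it returns $\sum_{i=0}^{k-1}\mathrm{AdapTrap}_{\rho,m,k}\big(f,\,c+\tfrac{(d-c)i}{k},\,c+\tfrac{(d-c)(i+1)}{k},\,\rho\tau\big)$. Let $A_{\rho,m,k,\tau}(f)$ be the full $k$-ary tree of the recursive calls made in the run of $\mathrm{AdapTrap}_{\rho,m,k}(f,a,b,\tau)$ (a call is a leaf if it accepts, and otherwise has $k$ children), and let $T_\infty$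 be the set of full $k$-ary trees of infinite depth; thus $A_{\rho,m,k,\tau}(f)\in T_\infty$ if and only if the procedure does not terminate. Let $\mathbb{P}^*$ be the law on $C([a,b])$ of the Gaussian process with mean $0$ and covariance function $\lambda\min(x,y)+\gamma$, let $Z\sim\mathcal{N}(0,1)$ with distribution function $\Phi$, and let $$\alpha=\mathbb{P}\left(|Z|<\frac{4m\tau}{\sqrt{\lambda(b-a)^3}}\right).$$ **Corollary (probability of non-termination for $k=2$).** Let $k=2$. (i) If $\rho=k^{-3/2}$ and $$\tau\le-\frac{\Phi^{-1}\left(\frac{1}{2k}\right)\sqrt{\lambda(b-a)^3}}{4m},$$ then $$\mathbb{P}^*\left(A_{\rho,m,k,\tau}\in T_\infty\right)=\frac{1-2\alpha}{1-\alpha}.$$ (ii) If $0<\rho<k^{-3/2}$, then (for every $\tau>0$) $$\mathbb{P}^*\left(A_{\rho,m,k,\tau}\in T_\infty\right)>\frac{1-2\alpha}{1-\alpha}.$$ -/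

import Mathlib

open MeasureTheory ProbabilityTheory Set

noncomputable section

namespace AdapTrap

/-- The composite trapezoidal rule for `g` on `[a, b]` with `n` subintervals. -/
def trap (g : ℝ → ℝ) (a b : ℝ) (n : ℕ) : ℝ :=
  (b - a) / (2 * n) * (g a + g b + 2 * ∑ i ∈ Finset.Ico 1 n, g (a + i * (b - a) / n))

/-- The local error estimate on `[a, b]` (with its sign). -/
def errEst (m : ℕ) (g : ℝ → ℝ) (a b : ℝ) : ℝ :=
  trap g a b (2 * m) - trap g a b m

/-- Big-step semantics of the recursive procedure: `Returns ρ m k g a b τ I` says that the call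
of the adaptive trapezoidal method on `(g, a, b, τ)` halts and returns the value `I`. -/
inductive Returns (ρ : ℝ) (m k : ℕ) (g : ℝ → ℝ) : ℝ → ℝ → ℝ → ℝ → Prop
  | accept (a b τ : ℝ) (h : |errEst m g a b| < τ) :
      Returns ρ m k g a b τ (trap g a b (2 * m))
  | subdivide (a b τ : ℝ) (I : Fin k → ℝ) (h : ¬ |errEst m g a b| < τ)
      (hI : ∀ i : Fin k, Returns ρ m k g (a + (b - a) * (i : ℕ) / k)
        (a + (b - a) * ((i : ℕ) + 1) / k) (ρ * τ) (I i)) :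
      Returns ρ m k g a b τ (∑ i, I i)

/-- Termination of the procedure. -/
def Terminates (ρ : ℝ) (m k : ℕ) (g : ℝ → ℝ) (a b τ : ℝ) : Prop :=
  ∃ I : ℝ, Returns ρ m k g a b τ I

/-- Possible nodes of a `k`-ary tree are pairs `(p, q)`: the node number `p` (counted from `0`)
at depth `q`. The children of `(p, q)` are `(k p + i, q + 1)` for `0 ≤ i < k`. -/
def IsChild (k : ℕ) (u v : ℕ × ℕ) : Prop :=
  ∃ i < k, v = (k * u.1 + i, u.2 + 1)

/-- Full `k`-ary trees (finite or infinite), as sets of nodes: the root is present, every other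
node has its parent present, and every node has all of its `k` children or none of them. -/
structure IsFullTree (k : ℕ) (T : Set (ℕ × ℕ)) : Prop where
  root_mem : (0, 0) ∈ T
  parent_mem : ∀ v ∈ T, v ≠ (0, 0) → ∃ u ∈ T, IsChild k u v
  full : ∀ u ∈ T, (∀ v, IsChild k u v → v ∈ T) ∨ (∀ v, IsChild k u v → v ∉ T)

/-- The set of full `k`-ary trees of infinite depth. -/
def infiniteTrees (k : ℕ) : Set (Set (ℕ × ℕ)) :=
  {T | IsFullTree k T ∧ ∀ n : ℕ, ∃ v ∈ T, n ≤ v.2}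

/-- Left end point of the subinterval belonging to the node `(p, q)`. -/
def left (k : ℕ) (a b : ℝ) (v : ℕ × ℕ) : ℝ := a + (b - a) * v.1 / (k : ℝ) ^ v.2

/-- Right end point of the subinterval belonging to the node `(p, q)`. -/
def right (k : ℕ) (a b : ℝ) (v : ℕ × ℕ) : ℝ := a + (b - a) * (v.1 + 1) / (k : ℝ) ^ v.2

/-- The recursive step at the node `u` does not accept, and calls the step at its child `v`. -/
def Calls (ρ : ℝ) (m k : ℕ) (g : ℝ → ℝ) (a b τ : ℝ) (u v : ℕ × ℕ) : Prop :=
  ¬ |errEst m g (left k a b u) (right k a b u)| < τ * ρ ^ u.2 ∧ IsChild k u v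

/-- The tree of the recursive steps made in the run of the procedure on `(g, a, b, τ)`. -/
def runTree (ρ : ℝ) (m k : ℕ) (g : ℝ → ℝ) (a b τ : ℝ) : Set (ℕ × ℕ) :=
  {v | Relation.ReflTransGen (Calls ρ m k g a b τ) (0, 0) v}

/-- The tree of the run on a continuous function `f` on `[a, b]`. All abscissae lie in `[a, b]`;
the constant extension of `f` to the real line only serves to write `f x` for real `x`. -/
def tree (ρ : ℝ) (m k : ℕ) {a b : ℝ} (hab : a ≤ b) (τ : ℝ) (f : C(Icc a b, ℝ)) :
    Set (ℕ × ℕ) :=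
  runTree ρ m k (IccExtend hab f) a b τ

theorem IsChild.parent_unique {k : ℕ} {u u' v : ℕ × ℕ} (h : IsChild k u v)
    (h' : IsChild k u' v) : u = u' := by
  obtain ⟨i, hi, rfl⟩ := h
  obtain ⟨j, hj, e⟩ := h'
  simp only [Prod.mk.injEq, add_left_inj] at e
  have hk : 0 < k := by omega
  refine Prod.ext ?_ e.2
  have h1 : (k * u.1 + i) / k = u.1 := by
    rw [Nat.mul_add_div hk, Nat.div_eq_of_lt hi, add_zero]
  have h2 : (k * u'.1 + j) / k = u'.1 := by
    rw [Nat.mul_add_div hk, Nat.div_eq_of_lt hj, add_zero]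
  rw [← h1, ← h2, e.1]

/-- The tree of a run is a full `k`-ary tree. -/
theorem runTree_isFullTree (ρ : ℝ) (m k : ℕ) (g : ℝ → ℝ) (a b τ : ℝ) :
    IsFullTree k (runTree ρ m k g a b τ) where
  root_mem := Relation.ReflTransGen.refl
  parent_mem v hv hne := by
    rcases Relation.ReflTransGen.cases_tail hv with h | ⟨u, hu, huv⟩
    · exact absurd h hne
    · exact ⟨u, hu, huv.2⟩
  full u hu := by
    by_cases h : |errEst m g (left k a b u) (right k a b u)| < τ * ρ ^ u.2
    · right
      intro v huv hv
      rcases Relation.ReflTransGen.cases_tail hv with h0 | ⟨w, _, hwv⟩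
      · obtain ⟨i, _, rfl⟩ := huv
        simp at h0
      · obtain rfl := huv.parent_unique hwv.2
        exact hwv.1 h
    · left
      intro v huv
      exact Relation.ReflTransGen.tail hu ⟨h, huv⟩

theorem left_child (k : ℕ) (a b : ℝ) (u : ℕ × ℕ) (i : ℕ) (hk : 0 < k) :
    left k a b (k * u.1 + i, u.2 + 1)
      = left k a b u + (right k a b u - left k a b u) * i / k := by
  have : (k : ℝ) ≠ 0 := by positivity
  simp only [left, right]
  push_cast
  field_simp
  ring

theorem right_child (k : ℕ) (a b : ℝ) (u : ℕ × ℕ) (i : ℕ) (hk : 0 < k) :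
    right k a b (k * u.1 + i, u.2 + 1)
      = left k a b u + (right k a b u - left k a b u) * (i + 1) / k := by
  have : (k : ℝ) ≠ 0 := by positivity
  simp only [left, right]
  push_cast
  field_simp
  ring

/-- The tree of a run has infinite depth if and only if the procedure does not terminate. -/
theorem runTree_mem_infiniteTrees_iff (ρ : ℝ) (m k : ℕ) (hk : 0 < k) (g : ℝ → ℝ) (a b τ : ℝ) :
    runTree ρ m k g a b τ ∈ infiniteTrees k ↔ ¬ Terminates ρ m k g a b τ := by
  constructor
  · rintro ⟨-, hinf⟩ ⟨I, hI⟩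
    have key : ∀ a' b' τ' I, Returns ρ m k g a' b' τ' I → ∀ u : ℕ × ℕ, a' = left k a b u →
        b' = right k a b u → τ' = τ * ρ ^ u.2 →
        ∃ N : ℕ, ∀ v, Relation.ReflTransGen (Calls ρ m k g a b τ) u v → v.2 ≤ N := by
      intro a' b' τ' I h
      induction h with
      | accept a' b' τ' h =>
        rintro u rfl rfl rfl
        refine ⟨u.2, fun v hv => ?_⟩
        rcases Relation.ReflTransGen.cases_head hv with rfl | ⟨w, hw, -⟩
        · exact le_rfl
        · exact absurd h hw.1
      | subdivide a' b' τ' I h hI ih =>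
        rintro u rfl rfl rfl
        have ih' : ∀ i : Fin k, ∃ N : ℕ, ∀ v, Relation.ReflTransGen (Calls ρ m k g a b τ)
            (k * u.1 + (i : ℕ), u.2 + 1) v → v.2 ≤ N := fun i =>
          ih i _ (left_child k a b u i hk).symm (right_child k a b u i hk).symm
            (by simp only [pow_succ]; ring)
        choose N hN using ih'
        refine ⟨u.2 + ∑ i, N i, fun v hv => ?_⟩
        rcases Relation.ReflTransGen.cases_head hv with rfl | ⟨w, hw, hwv⟩
        · omega
        · obtain ⟨-, i, hi, rfl⟩ := hw
          have h1 := hN ⟨i, hi⟩ v hwv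
          have h2 : N ⟨i, hi⟩ ≤ ∑ i, N i :=
            Finset.single_le_sum (fun _ _ => Nat.zero_le _) (Finset.mem_univ _)
          omega
    obtain ⟨N, hN⟩ := key a b τ I hI (0, 0) (by simp [left]) (by simp [right]) (by simp)
    obtain ⟨v, hv, hle⟩ := hinf (N + 1)
    have := hN v hv
    omega
  · intro hnt
    refine ⟨runTree_isFullTree ρ m k g a b τ, fun n => ?_⟩
    have key : ∃ u ∈ runTree ρ m k g a b τ, u.2 = n ∧
        ¬ Terminates ρ m k g (left k a b u) (right k a b u) (τ * ρ ^ u.2) := by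
      induction n with
      | zero => exact ⟨(0, 0), Relation.ReflTransGen.refl, rfl, by simpa [left, right] using hnt⟩
      | succ n ih =>
        obtain ⟨u, hu, rfl, hut⟩ := ih
        have h1 : ¬ |errEst m g (left k a b u) (right k a b u)| < τ * ρ ^ u.2 :=
          fun h => hut ⟨_, Returns.accept _ _ _ h⟩
        by_contra! hcon
        have h2 : ∀ i : Fin k, ∃ J, Returns ρ m k g
            (left k a b u + (right k a b u - left k a b u) * (i : ℕ) / k)
            (left k a b u + (right k a b u - left k a b u) * ((i : ℕ) + 1) / k)
            (ρ * (τ * ρ ^ u.2)) J := by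
          intro i
          have h3 := hcon (k * u.1 + (i : ℕ), u.2 + 1)
            (Relation.ReflTransGen.tail hu ⟨h1, i, i.2, rfl⟩) rfl
          rw [left_child k a b u i hk, right_child k a b u i hk,
            show τ * ρ ^ (u.2 + 1) = ρ * (τ * ρ ^ u.2) by ring] at h3
          exact h3
        choose J hJ using h2
        exact hut ⟨_, Returns.subdivide _ _ _ J h1 hJ⟩
    obtain ⟨u, hu, hn, -⟩ := key
    exact ⟨u, hu, hn.ge⟩

/-- `P` is the law on `C([a, b])` of the centred Gaussian process with covariance function
`lam * min x y + γ`. -/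
structure IsPrior {a b : ℝ} [MeasurableSpace C(Icc a b, ℝ)] (lam γ : ℝ)
    (P : Measure C(Icc a b, ℝ)) : Prop where
  gaussian : IsGaussianProcess (fun (x : Icc a b) (f : C(Icc a b, ℝ)) => f x) P
  mean : ∀ x : Icc a b, ∫ f, f x ∂P = 0
  cov : ∀ x y : Icc a b,
    cov[fun f : C(Icc a b, ℝ) => f x, fun f : C(Icc a b, ℝ) => f y; P]
      = lam * min (x : ℝ) (y : ℝ) + γ

/-- The quantile function of the standard normal distribution. -/
def normalQuantile (p : ℝ) : ℝ := sInf {x : ℝ | p ≤ cdf (gaussianReal 0 1) x}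

/-- The probability `ℙ(|Z| < 4 m τ / √(lam (b - a)³))` for a standard normal `Z`. -/
def acceptProb (m : ℕ) (lam a b τ : ℝ) : ℝ :=
  (gaussianReal 0 1).real {z : ℝ | |z| < 4 * m * τ / √(lam * (b - a) ^ 3)}

end AdapTrap

end

/-! The error estimate at a node is a multiple of a sum of midpoint second differences over the
cells of a dyadically refined grid (`errEst_node`). Under the covariance `lam * min x y + γ` these
are Haar coefficients of Brownian motion: pairwise uncorrelated across all cells and depths
(`IsPrior.covariance_haar`), the constant `γ` cancelling. Joint Gaussianity makes the acceptance
events of distinct nodes independent (`IsPrior.iIndepSet_acceptSet`).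

The standard deviation of the estimate shrinks by `2 ^ (3/2)` per level and the tolerance by `ρ`, so
a node at depth `q` accepts with probability `normalAbsLt (c * (ρ * 2 ^ (3/2)) ^ q)`, where `c = 4mτ
/ √(lam (b - a)³)`. The run is thus a binary branching process with generation-dependent offspring
law, and non-termination is survival.

Extinction obeys `x = α + (1 - α) x²`, with roots `1` and `α / (1 - α)`. At the critical `ρ` the law
is homogeneous and the quantile condition says `α ≤ 1/2`, so extinction has the smaller root as its
probability. For smaller `ρ` later generations accept strictly less often, so survival is strictly
likelier; if `α > 1/2` the claimed bound is negative. -/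

noncomputable section

namespace AdapTrap

/-! ### Binary branching with independent leaf events -/

section Branching

variable {Ω : Type*}

/-- The event that the binary tree grown from the node `u`, in which a node `v` is a leaf on the
event `A v`, has fewer than `n` generations. -/
def extinct (A : ℕ × ℕ → Set Ω) : ℕ → ℕ × ℕ → Set Ω
  | 0, _ => ∅
  | n + 1, u => A u ∪ (extinct A n (2 * u.1, u.2 + 1) ∩ extinct A n (2 * u.1 + 1, u.2 + 1))

/-- The nodes of the complete binary tree below `u`. -/
def descendants (u : ℕ × ℕ) : Set (ℕ × ℕ) :=
  {v | u.2 ≤ v.2 ∧ v.1 / 2 ^ (v.2 - u.2) = u.1}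

theorem self_mem_descendants (u : ℕ × ℕ) : u ∈ descendants u := by
  simp [descendants]

theorem descendants_child_subset (u : ℕ × ℕ) {i : ℕ} (hi : i < 2) :
    descendants (2 * u.1 + i, u.2 + 1) ⊆ descendants u := by
  rintro v ⟨h1, h2⟩
  simp only at h1 h2
  refine ⟨by omega, ?_⟩
  rw [show v.2 - u.2 = v.2 - (u.2 + 1) + 1 by omega, pow_succ, ← Nat.div_div_eq_div_mul, h2]
  omega

theorem disjoint_descendants_children (u : ℕ × ℕ) :
    Disjoint (descendants (2 * u.1, u.2 + 1)) (descendants (2 * u.1 + 1, u.2 + 1)) := by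
  rw [Set.disjoint_left]
  rintro v ⟨-, h1⟩ ⟨-, h2⟩
  simp only at h1 h2
  omega

theorem disjoint_self_descendants_children (u : ℕ × ℕ) :
    Disjoint {u} (descendants (2 * u.1, u.2 + 1) ∪ descendants (2 * u.1 + 1, u.2 + 1)) := by
  rw [Set.disjoint_left]
  rintro v rfl (⟨h, -⟩ | ⟨h, -⟩) <;> simp at h

theorem extinct_mono (A : ℕ × ℕ → Set Ω) (n : ℕ) (u : ℕ × ℕ) :
    extinct A n u ⊆ extinct A (n + 1) u := by
  induction n generalizing u with
  | zero => exact Set.empty_subset _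
  | succ n ih => exact Set.union_subset_union_right _ (Set.inter_subset_inter (ih _) (ih _))

/-- Extinction below `u` involves only the leaf events of its subtree. Disjoint subtrees therefore
yield independent extinction events. -/
theorem measurableSet_extinct_iSup (A : ℕ × ℕ → Set Ω) (n : ℕ) (u : ℕ × ℕ) :
    MeasurableSet[⨆ v ∈ descendants u, MeasurableSpace.generateFrom {A v}] (extinct A n u) := by
  induction n generalizing u with
  | zero => exact @MeasurableSet.empty Ω (⨆ v ∈ descendants u, MeasurableSpace.generateFrom {A v})
  | succ n ih =>
    have h0 := biSup_mono (f := fun v => MeasurableSpace.generateFrom {A v})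
      (descendants_child_subset u (i := 0) (by norm_num))
    have h1 := biSup_mono (f := fun v => MeasurableSpace.generateFrom {A v})
      (descendants_child_subset u (i := 1) (by norm_num))
    have h2 : MeasurableSpace.generateFrom {A u} ≤
        ⨆ v ∈ descendants u, MeasurableSpace.generateFrom {A v} :=
      le_biSup (fun v => MeasurableSpace.generateFrom {A v}) (self_mem_descendants u)
    exact @MeasurableSet.union _ _ _ _
      (h2 _ (MeasurableSpace.measurableSet_generateFrom (mem_singleton _)))
      (@MeasurableSet.inter _ _ _ _ (h0 _ (ih _)) (h1 _ (ih _)))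

variable [MeasurableSpace Ω]

theorem measurableSet_extinct {A : ℕ × ℕ → Set Ω} (hA : ∀ u, MeasurableSet (A u)) (n : ℕ)
    (u : ℕ × ℕ) : MeasurableSet (extinct A n u) := by
  induction n generalizing u with
  | zero => exact MeasurableSet.empty
  | succ n ih => exact (hA u).union ((ih _).inter (ih _))

/-- The node and its two child subtrees are disjoint index sets, hence independent;
inclusion-exclusion then gives the recursion. -/
theorem measureReal_extinct_succ {P : Measure Ω} [IsProbabilityMeasure P] {A : ℕ × ℕ → Set Ω}
    (hA : ∀ u, MeasurableSet (A u)) (hind : iIndepSet A P) (n : ℕ) (u : ℕ × ℕ) :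
    P.real (extinct A (n + 1) u) = P.real (A u) + (1 - P.real (A u)) *
      (P.real (extinct A n (2 * u.1, u.2 + 1)) *
        P.real (extinct A n (2 * u.1 + 1, u.2 + 1))) := by
  have hle : ∀ v, MeasurableSpace.generateFrom {A v} ≤ ‹MeasurableSpace Ω› := fun v =>
    MeasurableSpace.generateFrom_le (by rintro _ rfl; exact hA v)
  have hind' : iIndep (fun v => MeasurableSpace.generateFrom {A v}) P := hind
  set B := extinct A n (2 * u.1, u.2 + 1) with hB
  set C := extinct A n (2 * u.1 + 1, u.2 + 1) with hC
  have hBC : P.real (B ∩ C) = P.real B * P.real C := by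
    simp only [measureReal_def]
    rw [← ENNReal.toReal_mul]
    congr 1
    exact (Indep_iff _ _ _).1
      (indep_iSup_of_disjoint hle hind' (disjoint_descendants_children u)) B C
      (measurableSet_extinct_iSup A n _) (measurableSet_extinct_iSup A n _)
  have hABC : P.real (A u ∩ (B ∩ C)) = P.real (A u) * P.real (B ∩ C) := by
    simp only [measureReal_def]
    rw [← ENNReal.toReal_mul]
    congr 1
    refine (Indep_iff _ _ _).1
      (indep_iSup_of_disjoint hle hind' (disjoint_self_descendants_children u)) _ _ ?_ ?_
    · have h : MeasurableSpace.generateFrom {A u} ≤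
          ⨆ v ∈ ({u} : Set (ℕ × ℕ)), MeasurableSpace.generateFrom {A v} :=
        le_biSup (fun v => MeasurableSpace.generateFrom {A v}) (mem_singleton u)
      exact h _ (MeasurableSpace.measurableSet_generateFrom (mem_singleton _))
    · have h0 := biSup_mono (f := fun v => MeasurableSpace.generateFrom {A v})
        (Set.subset_union_left (s := descendants (2 * u.1, u.2 + 1))
          (t := descendants (2 * u.1 + 1, u.2 + 1)))
      have h1 := biSup_mono (f := fun v => MeasurableSpace.generateFrom {A v})
        (Set.subset_union_right (s := descendants (2 * u.1, u.2 + 1))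
          (t := descendants (2 * u.1 + 1, u.2 + 1)))
      exact @MeasurableSet.inter _ _ _ _ (h0 _ (measurableSet_extinct_iSup A n _))
        (h1 _ (measurableSet_extinct_iSup A n _))
  have h := measureReal_union_add_inter (μ := P) (s := A u) (t := B ∩ C)
    ((measurableSet_extinct hA n _).inter (measurableSet_extinct hA n _))
  rw [extinct, ← hBC]
  rw [hABC] at h
  linarith

/-- The probability that a binary branching process, started in generation `q` and in which the
individuals of generation `j` have no offspring with probability `α j`, is extinct after `n`
generations. -/
def extinctProb (α : ℕ → ℝ) : ℕ → ℕ → ℝ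
  | 0, _ => 0
  | n + 1, q => α q + (1 - α q) * extinctProb α n (q + 1) ^ 2

theorem measureReal_extinct {P : Measure Ω} [IsProbabilityMeasure P] {A : ℕ × ℕ → Set Ω}
    (hA : ∀ u, MeasurableSet (A u)) (hind : iIndepSet A P) {α : ℕ → ℝ}
    (hα : ∀ u : ℕ × ℕ, u.1 < 2 ^ u.2 → P.real (A u) = α u.2) (n : ℕ) (u : ℕ × ℕ)
    (hu : u.1 < 2 ^ u.2) : P.real (extinct A n u) = extinctProb α n u.2 := by
  induction n generalizing u with
  | zero => simp [extinct, extinctProb]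
  | succ n ih =>
    rw [measureReal_extinct_succ hA hind, hα u hu, ih _ (by simp only [pow_succ]; omega),
      ih _ (by simp only [pow_succ]; omega), extinctProb, sq]

/-- Continuity from below along the increasing events `extinct A n (0, 0)`, whose union is the
complement of survival. -/
theorem tendsto_extinctProb {P : Measure Ω} [IsProbabilityMeasure P] {A : ℕ × ℕ → Set Ω}
    (hA : ∀ u, MeasurableSet (A u)) (hind : iIndepSet A P) {α : ℕ → ℝ}
    (hα : ∀ u : ℕ × ℕ, u.1 < 2 ^ u.2 → P.real (A u) = α u.2) :
    Filter.Tendsto (fun n => extinctProb α n 0) Filter.atTop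
      (nhds (1 - P.real (⋂ n, (extinct A n (0, 0))ᶜ))) := by
  have h1 : P.real (⋂ n, (extinct A n (0, 0))ᶜ) = 1 - P.real (⋃ n, extinct A n (0, 0)) := by
    rw [← compl_iUnion, probReal_compl_eq_one_sub
      (MeasurableSet.iUnion fun n => measurableSet_extinct hA n _)]
  rw [h1, sub_sub_cancel]
  have h2 := tendsto_measure_iUnion_atTop (μ := P) (s := fun n => extinct A n (0, 0))
    (monotone_nat_of_le_succ fun n => extinct_mono A n _)
  have h3 := (ENNReal.tendsto_toReal (measure_ne_top P _)).comp h2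
  refine h3.congr fun n => ?_
  change P.real (extinct A n (0, 0)) = _
  rw [measureReal_extinct hA hind hα n (0, 0) (by simp)]

end Branching

/-! ### Bounds and limits of the extinction recursion -/

theorem extinctProb_nonneg {α : ℕ → ℝ} (h0 : ∀ q, 0 ≤ α q) (h1 : ∀ q, α q ≤ 1) (n q : ℕ) :
    0 ≤ extinctProb α n q := by
  cases n with
  | zero => exact le_rfl
  | succ n => exact add_nonneg (h0 q) (mul_nonneg (sub_nonneg.2 (h1 q)) (sq_nonneg _))

/-- The extinction probability is bounded by that of the homogeneous process whose offspring law
has the largest probability of no offspring. -/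
theorem extinctProb_le {α : ℕ → ℝ} {β : ℝ} (h0 : ∀ q, 0 ≤ α q) (hβ : β ≤ 1 / 2) {q₀ : ℕ}
    (h : ∀ q, q₀ ≤ q → α q ≤ β) (h1 : ∀ q, α q ≤ 1) (n q : ℕ) (hq : q₀ ≤ q) :
    extinctProb α n q ≤ β / (1 - β) := by
  have hβ0 : 0 ≤ β := (h0 q₀).trans (h q₀ le_rfl)
  have hpos : 0 < 1 - β := by linarith
  have hs1 : β / (1 - β) ≤ 1 := by rw [div_le_one hpos]; linarith
  have hfix : β + (1 - β) * (β / (1 - β)) ^ 2 = β / (1 - β) := by field_simp; ring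
  induction n generalizing q with
  | zero => exact div_nonneg hβ0 hpos.le
  | succ n ih =>
    have hle := ih (q + 1) (by omega)
    have hnn := extinctProb_nonneg h0 h1 n (q + 1)
    have hsq : extinctProb α n (q + 1) ^ 2 ≤ (β / (1 - β)) ^ 2 := pow_le_pow_left₀ hnn hle 2
    -- Since the square is at most `1`, `x + (1 - x) * s ^ 2` increases in `x`, so `α q` may be
    -- replaced by `β`.
    have hsq1 : (β / (1 - β)) ^ 2 ≤ 1 := pow_le_one₀ (hnn.trans hle) hs1
    rw [extinctProb, ← hfix]
    nlinarith [h q hq, h1 q]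

/-- The extinction probability of a homogeneous critical or supercritical binary branching
process. -/
theorem eq_of_tendsto_extinctProb_const {β L : ℝ} (hβ0 : 0 ≤ β) (hβ : β ≤ 1 / 2)
    (hL : Filter.Tendsto (fun n => extinctProb (fun _ => β) n 0) Filter.atTop (nhds L)) :
    L = β / (1 - β) := by
  have hpos : 0 < 1 - β := by linarith
  have hconst : ∀ n q, extinctProb (fun _ => β) n q = extinctProb (fun _ => β) n 0 := by
    intro n
    induction n with
    | zero => intro q; rfl
    | succ n ih => intro q; simp only [extinctProb, ih (q + 1), ih (0 + 1)]
  have hle : L ≤ β / (1 - β) := le_of_tendsto' hL fun n =>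
    extinctProb_le (fun _ => hβ0) hβ (q₀ := 0) (fun _ _ => le_rfl) (fun _ => by linarith) n 0 le_rfl
  have h2 : Filter.Tendsto (fun n => extinctProb (fun _ => β) (n + 1) 0) Filter.atTop
      (nhds (β + (1 - β) * L ^ 2)) := by
    simp only [extinctProb, hconst _ (0 + 1)]
    exact ((hL.pow 2).const_mul _).const_add _
  have hfix : L = β + (1 - β) * L ^ 2 :=
    tendsto_nhds_unique ((Filter.tendsto_add_atTop_iff_nat 1).2 hL) h2
  -- The upper bound on `L` selects the smaller root; `L = 1` is possible only at `β = 1/2`, where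
  -- the roots coincide.
  have hfac : (L - 1) * ((1 - β) * L - β) = 0 := by linarith
  rw [eq_div_iff hpos.ne']
  rw [le_div_iff₀ hpos] at hle
  rcases mul_eq_zero.1 hfac with h | h
  · obtain rfl : L = 1 := by linarith
    linarith
  · linarith

/-- From generation `1` on, compare with the homogeneous process of parameter `α 1`, whose smaller
root is strictly below that for `α 0`. One step of the recursion keeps the inequality strict. -/
theorem lt_of_tendsto_extinctProb {α : ℕ → ℝ} {L : ℝ} (h0 : ∀ q, 0 ≤ α q) (hanti : Antitone α)
    (hlt : α 1 < α 0) (hα : α 0 ≤ 1 / 2)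
    (hL : Filter.Tendsto (fun n => extinctProb α n 0) Filter.atTop (nhds L)) :
    L < α 0 / (1 - α 0) := by
  have hle1 : ∀ q, α q ≤ 1 := fun q => (hanti (Nat.zero_le q)).trans (by linarith)
  have hpos : 0 < 1 - α 0 := by linarith
  have hpos1 : 0 < 1 - α 1 := by linarith
  have hs : α 1 / (1 - α 1) < α 0 / (1 - α 0) := by
    rw [div_lt_div_iff₀ hpos1 hpos]; nlinarith
  have hs0 : 0 ≤ α 1 / (1 - α 1) := div_nonneg (h0 1) hpos1.le
  have hle : L ≤ α 0 + (1 - α 0) * (α 1 / (1 - α 1)) ^ 2 := by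
    refine le_of_tendsto' ((Filter.tendsto_add_atTop_iff_nat 1).2 hL) fun n => ?_
    have h1 := extinctProb_le h0 (by linarith : α 1 ≤ 1 / 2) (fun q hq => hanti hq) hle1 n 1 le_rfl
    have h2 := pow_le_pow_left₀ (extinctProb_nonneg h0 hle1 n 1) h1 2
    simp only [extinctProb, zero_add]
    gcongr
  have hfix : α 0 + (1 - α 0) * (α 0 / (1 - α 0)) ^ 2 = α 0 / (1 - α 0) := by field_simp; ring
  refine hle.trans_lt (hfix ▸ ?_)
  gcongr

/-! ### The run of the procedure as a branching process -/

/-- The event that the step at the node `u` of the run accepts. -/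
def acceptSet (ρ : ℝ) (m : ℕ) {a b : ℝ} (hab : a ≤ b) (τ : ℝ) (u : ℕ × ℕ) :
    Set C(Icc a b, ℝ) :=
  {f | |errEst m (IccExtend hab f) (left 2 a b u) (right 2 a b u)| < τ * ρ ^ u.2}

theorem mem_extinct_iff (ρ : ℝ) (m : ℕ) {a b : ℝ} (hab : a ≤ b) (τ : ℝ) (f : C(Icc a b, ℝ))
    (n : ℕ) (u : ℕ × ℕ) :
    f ∈ extinct (acceptSet ρ m hab τ) n u ↔
      ∀ v, Relation.ReflTransGen (Calls ρ m 2 (IccExtend hab f) a b τ) u v → v.2 < u.2 + n := by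
  induction n generalizing u with
  | zero =>
    simp only [extinct, mem_empty_iff_false, false_iff, not_forall]
    exact ⟨u, .refl, by simp⟩
  | succ n ih =>
    simp only [extinct, mem_union, mem_inter_iff, ih]
    constructor
    · intro h v hv
      rcases Relation.ReflTransGen.cases_head hv with rfl | ⟨w, hw, hwv⟩
      · omega
      · obtain ⟨hna, i, hi, rfl⟩ := hw
        rcases h with h | ⟨h1, h2⟩
        · exact absurd h hna
        · obtain rfl | rfl : i = 0 ∨ i = 1 := by omega
          · have := h1 v hwv; omega
          · have := h2 v hwv; omega
    · intro h
      by_cases ha : f ∈ acceptSet ρ m hab τ u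
      · exact Or.inl ha
      · refine Or.inr ⟨fun v hv => ?_, fun v hv => ?_⟩
        · have := h v (.head ⟨ha, 0, by norm_num, rfl⟩ hv); omega
        · have := h v (.head ⟨ha, 1, by norm_num, rfl⟩ hv); omega

/-- The run tree is always full, so only its depth matters. -/
theorem setOf_tree_mem_infiniteTrees (ρ : ℝ) (m : ℕ) {a b : ℝ} (hab : a ≤ b) (τ : ℝ) :
    {f | tree ρ m 2 hab τ f ∈ infiniteTrees 2} =
      ⋂ n, (extinct (acceptSet ρ m hab τ) n (0, 0))ᶜ := by
  ext f
  simp only [mem_ofPred_eq, mem_iInter, mem_compl_iff, mem_extinct_iff, not_forall, not_lt,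
    zero_add]
  constructor
  · rintro ⟨-, h⟩ n
    obtain ⟨v, hv, hn⟩ := h n
    exact ⟨v, hv, hn⟩
  · intro h
    refine ⟨runTree_isFullTree _ _ _ _ _ _ _, fun n => ?_⟩
    obtain ⟨v, hv, hn⟩ := h n
    exact ⟨v, hv, hn⟩

/-! ### Error estimates as sums of Haar coefficients -/

section Haar

/-- The second difference of `g` on `[l, r]`, with its sign reversed. -/
def secDiff (g : ℝ → ℝ) (l r : ℝ) : ℝ := 2 * g ((l + r) / 2) - g l - g r

theorem sum_Ico_one_two_mul (φ : ℕ → ℝ) (m : ℕ) (hm : 0 < m) :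
    ∑ i ∈ Finset.Ico 1 (2 * m), φ i =
      ∑ i ∈ Finset.range m, φ (2 * i + 1) + ∑ i ∈ Finset.Ico 1 m, φ (2 * i) := by
  induction m, hm using Nat.le_induction with
  | base => simp
  | succ n hn ih =>
    rw [show 2 * (n + 1) = 2 * n + 1 + 1 by ring, Finset.sum_Ico_succ_top (by omega),
      Finset.sum_Ico_succ_top (by omega), ih, Finset.sum_range_succ,
      Finset.sum_Ico_succ_top (by omega)]
    ring

/-- Doubling the number of cells only adds midpoints; on a cell of width `h` the rule changes by `h
/ 4` times the second difference. -/
theorem errEst_eq_sum_secDiff (m : ℕ) (hm : 0 < m) (g : ℝ → ℝ) (c d : ℝ) :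
    errEst m g c d = (d - c) / (4 * m) *
      ∑ i ∈ Finset.range m, secDiff g (c + i * (d - c) / m) (c + (i + 1) * (d - c) / m) := by
  have hm0 : (m : ℝ) ≠ 0 := by positivity
  have hodd : ∀ i : ℕ, (c + i * (d - c) / m + (c + (i + 1) * (d - c) / m)) / 2 =
      c + ((2 * i + 1 : ℕ) : ℝ) * (d - c) / ((2 * m : ℕ) : ℝ) := by
    intro i; push_cast; field_simp; ring
  have heven : ∀ i : ℕ, c + ((2 * i : ℕ) : ℝ) * (d - c) / ((2 * m : ℕ) : ℝ) =
      c + i * (d - c) / m := by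
    intro i; push_cast; field_simp
  have h1 : ∑ i ∈ Finset.range m, g (c + i * (d - c) / m) =
      g c + ∑ i ∈ Finset.Ico 1 m, g (c + i * (d - c) / m) := by
    rw [Finset.range_eq_Ico, Finset.sum_eq_sum_Ico_succ_bot hm]; simp
  have h2 : ∑ i ∈ Finset.range m, g (c + (i + 1) * (d - c) / m) =
      ∑ i ∈ Finset.Ico 1 m, g (c + i * (d - c) / m) + g d := by
    have := Finset.sum_Ico_add' (fun i : ℕ => g (c + i * (d - c) / m)) 0 m 1
    simp only [Nat.cast_add, Nat.cast_one] at this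
    rw [Finset.range_eq_Ico, this, zero_add, Finset.sum_Ico_succ_top (by omega),
      mul_div_cancel_left₀ _ hm0, add_sub_cancel]
  simp only [secDiff, Finset.sum_sub_distrib, ← Finset.mul_sum, h1, h2, hodd]
  rw [errEst, trap, trap, sum_Ico_one_two_mul _ m hm]
  simp only [heven]
  push_cast
  field_simp
  ring

/-- The `j`-th point of the grid on `[a, b]` with `m * 2 ^ q` cells. -/
def gridPt (m : ℕ) (a b : ℝ) (q j : ℕ) : ℝ := a + (b - a) * j / (m * 2 ^ q)

theorem gridPt_mono (m : ℕ) {a b : ℝ} (hab : a ≤ b) (q : ℕ) : Monotone (gridPt m a b q) := by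
  intro i j hij
  have := sub_nonneg.2 hab
  unfold gridPt
  gcongr

theorem gridPt_refine (m : ℕ) (a b : ℝ) (q j d : ℕ) :
    gridPt m a b (q + d) (j * 2 ^ d) = gridPt m a b q j := by
  simp only [gridPt, pow_add]
  push_cast
  rw [← mul_assoc, ← mul_assoc, mul_div_mul_right _ _ (by positivity)]

theorem gridPt_midpoint (m : ℕ) (a b : ℝ) (q j : ℕ) :
    (gridPt m a b q j + gridPt m a b q (j + 1)) / 2 = gridPt m a b (q + 1) (2 * j + 1) := by
  simp only [gridPt, pow_succ]
  push_cast
  rw [← mul_assoc (m : ℝ), ← div_div _ _ (2 : ℝ)]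
  ring

theorem gridPt_last {m : ℕ} (hm : 0 < m) (a b : ℝ) (q : ℕ) :
    gridPt m a b q (m * 2 ^ q) = b := by
  simp only [gridPt]
  push_cast
  rw [mul_div_cancel_right₀ _ (by positivity)]
  ring

theorem left_le_gridPt (m : ℕ) {a b : ℝ} (hab : a ≤ b) (q j : ℕ) : a ≤ gridPt m a b q j := by
  have := sub_nonneg.2 hab
  simp only [gridPt, le_add_iff_nonneg_right]
  positivity

/-- The contribution of the `j`-th cell of the `q`-th grid to the local error estimates. -/
def haar (m : ℕ) (a b : ℝ) (g : ℝ → ℝ) (q j : ℕ) : ℝ :=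
  secDiff g (gridPt m a b q j) (gridPt m a b q (j + 1))

theorem errEst_node (m : ℕ) (hm : 0 < m) (g : ℝ → ℝ) (a b : ℝ) (u : ℕ × ℕ) :
    errEst m g (left 2 a b u) (right 2 a b u) = (b - a) / (4 * m * 2 ^ u.2) *
      ∑ i ∈ Finset.range m, haar m a b g u.2 (m * u.1 + i) := by
  have hm0 : (m : ℝ) ≠ 0 := by positivity
  have hw : right 2 a b u - left 2 a b u = (b - a) / 2 ^ u.2 := by
    simp only [left, right]; push_cast; field_simp; ring
  rw [errEst_eq_sum_secDiff m hm, hw]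
  congr 1
  · field_simp
  · refine Finset.sum_congr rfl fun i _ => ?_
    simp only [haar, gridPt, left]
    push_cast
    congr 1 <;> field_simp <;> ring

/-- The tent function with corners `l`, `c` and `r`. -/
def tent (l c r x : ℝ) : ℝ := 2 * min x c - min x l - min x r

theorem tent_eq_zero {l c r x : ℝ} (hlc : l ≤ c) (hcr : c ≤ r) (h : l + r = 2 * c)
    (hx : x ≤ l ∨ r ≤ x) : tent l c r x = 0 := by
  rcases hx with hx | hx
  · rw [tent, min_eq_left (hx.trans hlc), min_eq_left hx, min_eq_left (hx.trans (hlc.trans hcr))]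
    ring
  · rw [tent, min_eq_right (hcr.trans hx), min_eq_right ((hlc.trans hcr).trans hx),
      min_eq_right hx]
    linarith

/-- The projection of the real line to `[a, b]`. -/
def clamp (a b x : ℝ) : ℝ := max a (min b x)

theorem clamp_mono (a b : ℝ) : Monotone (clamp a b) := fun _ _ h =>
  max_le_max_left _ (min_le_min_left _ h)

theorem clamp_of_mem {a b x : ℝ} (h1 : a ≤ x) (h2 : x ≤ b) : clamp a b x = x := by
  rw [clamp, min_eq_right h2, max_eq_right h1]

theorem clamp_of_ge {a b x : ℝ} (hab : a ≤ b) (h : b ≤ x) : clamp a b x = b := by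
  rw [clamp, min_eq_left h, max_eq_right hab]

theorem midpoint_mem_cell {m : ℕ} {a b : ℝ} (hab : a ≤ b) (q j : ℕ) :
    gridPt m a b q j ≤ gridPt m a b (q + 1) (2 * j + 1) ∧
      gridPt m a b (q + 1) (2 * j + 1) ≤ gridPt m a b q (j + 1) := by
  have := gridPt_mono m hab q (Nat.le_succ j)
  rw [← gridPt_midpoint]
  constructor <;> simp only [Nat.succ_eq_add_one] at this <;> linarith

/-- As `b` is a grid point, a cell either lies in `[a, b]`, where clamping does nothing, or
collapses to the point `b`. Node numbers beyond the tree thus need no separate treatment. -/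
theorem clamp_cell {m : ℕ} (hm : 0 < m) {a b : ℝ} (hab : a ≤ b) (q j : ℕ) :
    clamp a b (gridPt m a b q j) + clamp a b (gridPt m a b q (j + 1)) =
      2 * clamp a b (gridPt m a b (q + 1) (2 * j + 1)) := by
  obtain ⟨h1, h2⟩ := midpoint_mem_cell (m := m) hab q j
  have ha := left_le_gridPt m hab q j
  rcases Nat.lt_or_ge j (m * 2 ^ q) with h | h
  · have hb : gridPt m a b q (j + 1) ≤ b := by
      simpa [gridPt_last hm] using gridPt_mono m hab q (Nat.succ_le_of_lt h)
    rw [clamp_of_mem ha (h1.trans (h2.trans hb)), clamp_of_mem (ha.trans (h1.trans h2)) hb,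
      clamp_of_mem (ha.trans h1) (h2.trans hb), ← gridPt_midpoint]
    ring
  · have hb : b ≤ gridPt m a b q j := by
      simpa [gridPt_last hm] using gridPt_mono m hab q h
    rw [clamp_of_ge hab hb, clamp_of_ge hab (hb.trans h1), clamp_of_ge hab (hb.trans (h1.trans h2))]
    ring

/-- The end points and the midpoint of a cell are not interior to any other cell that is not
larger. -/
theorem gridPt_not_interior (m : ℕ) {a b : ℝ} (hab : a ≤ b) {q q' j j' s : ℕ} (hq : q ≤ q')
    (hne : (q, j) ≠ (q', j')) (h1 : 2 * j ≤ s) (h2 : s ≤ 2 * j + 2) :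
    gridPt m a b (q + 1) s ≤ gridPt m a b q' j' ∨
      gridPt m a b q' (j' + 1) ≤ gridPt m a b (q + 1) s := by
  rcases hq.eq_or_lt with rfl | hlt
  · have hj : j ≠ j' := fun h => hne (by rw [h])
    rw [← gridPt_refine m a b q j' 1, ← gridPt_refine m a b q (j' + 1) 1]
    rcases Nat.lt_or_gt_of_ne hj with h | h
    · exact Or.inl (gridPt_mono m hab _ (by omega))
    · exact Or.inr (gridPt_mono m hab _ (by omega))
  -- The point belongs to the finer grid too, with index `s * 2 ^ d`, so it is interior to none of
  -- its cells.
  · obtain ⟨d, rfl⟩ := Nat.exists_eq_add_of_lt hlt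
    rw [← gridPt_refine m a b (q + 1) s d, show q + 1 + d = q + d + 1 by ring]
    rcases Nat.lt_or_ge j' (s * 2 ^ d) with h | h
    · exact Or.inr (gridPt_mono m hab _ h)
    · exact Or.inl (gridPt_mono m hab _ h)

end Haar

/-! ### Covariances and independence under the prior -/

section Gaussian

/-- A process whose values are linear functions of finitely many values of a Gaussian process is
Gaussian. -/
theorem _root_.ProbabilityTheory.IsGaussianProcess.of_linear_restrict {S T Ω : Type*}
    {mΩ : MeasurableSpace Ω} {P : Measure Ω} {X : T → Ω → ℝ} {Y : S → Ω → ℝ}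
    (hX : IsGaussianProcess X P)
    (h : ∀ s, ∃ I : Finset T, ∃ L : (I → ℝ) →L[ℝ] ℝ, ∀ ω, Y s ω = L (I.restrict (X · ω))) :
    IsGaussianProcess Y P where
  hasGaussianLaw I := by
    classical
    choose J L hL using h
    let K : (I.biUnion J → ℝ) →L[ℝ] I → ℝ := ContinuousLinearMap.pi fun s =>
      (L s).comp (ContinuousLinearMap.pi fun t =>
        ContinuousLinearMap.proj ⟨t.1, Finset.mem_biUnion.2 ⟨s.1, s.2, t.2⟩⟩)
    have hK := (hX.hasGaussianLaw (I.biUnion J)).map K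
    convert! hK using 1
    ext ω s
    exact hL s ω

variable {a b : ℝ} (hab : a < b) [MeasurableSpace C(Icc a b, ℝ)]
  {lam γ : ℝ} {P : Measure C(Icc a b, ℝ)} (hP : IsPrior lam γ P) (m : ℕ) (hm : 0 < m)

include hP

theorem IsPrior.isProbabilityMeasure : IsProbabilityMeasure P := hP.gaussian.isProbabilityMeasure

theorem IsPrior.isGaussianProcess_IccExtend :
    IsGaussianProcess (fun (x : ℝ) (f : C(Icc a b, ℝ)) => IccExtend hab.le f x) P :=
  hP.gaussian.comp_right (projIcc a b hab.le)

theorem IsPrior.memLp_IccExtend (x : ℝ) :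
    MemLp (fun f : C(Icc a b, ℝ) => IccExtend hab.le f x) 2 P :=
  ((hP.isGaussianProcess_IccExtend hab).hasGaussianLaw_eval x).memLp_two

theorem IsPrior.integral_IccExtend (x : ℝ) :
    ∫ f : C(Icc a b, ℝ), IccExtend hab.le f x ∂P = 0 :=
  hP.mean _

theorem IsPrior.covariance_IccExtend (x y : ℝ) :
    cov[fun f : C(Icc a b, ℝ) => IccExtend hab.le f x,
      fun f : C(Icc a b, ℝ) => IccExtend hab.le f y; P] =
      lam * min (clamp a b x) (clamp a b y) + γ := by
  have := hP.cov (projIcc a b hab.le x) (projIcc a b hab.le y)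
  rwa [coe_projIcc, coe_projIcc] at this

theorem IsPrior.memLp_secDiff (l r : ℝ) :
    MemLp (fun f : C(Icc a b, ℝ) => secDiff (IccExtend hab.le f) l r) 2 P :=
  (((hP.memLp_IccExtend hab _).const_mul 2).sub (hP.memLp_IccExtend hab _)).sub
    (hP.memLp_IccExtend hab _)

theorem IsPrior.covariance_secDiff_left (l r : ℝ) {Z : C(Icc a b, ℝ) → ℝ} (hZ : MemLp Z 2 P) :
    cov[fun f : C(Icc a b, ℝ) => secDiff (IccExtend hab.le f) l r, Z; P] =
      2 * cov[fun f : C(Icc a b, ℝ) => IccExtend hab.le f ((l + r) / 2), Z; P] -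
        cov[fun f : C(Icc a b, ℝ) => IccExtend hab.le f l, Z; P] -
        cov[fun f : C(Icc a b, ℝ) => IccExtend hab.le f r, Z; P] := by
  have := hP.isProbabilityMeasure
  have h := hP.memLp_IccExtend hab
  have h2 : ∀ x y, MemLp (fun f : C(Icc a b, ℝ) =>
      2 * IccExtend hab.le f x - IccExtend hab.le f y) 2 P := fun x y =>
    ((h x).const_mul 2).sub (h y)
  simp only [secDiff]
  rw [covariance_fun_sub_left (h2 _ _) (h _) hZ,
    covariance_fun_sub_left ((h _).const_mul 2) (h _) hZ, covariance_const_mul_left]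

/-- The coefficients `2, -1, -1` sum to zero, which removes `γ` and leaves a tent function. -/
theorem IsPrior.covariance_IccExtend_secDiff (x l r : ℝ) :
    cov[fun f : C(Icc a b, ℝ) => IccExtend hab.le f x,
      fun f => secDiff (IccExtend hab.le f) l r; P] =
      lam * tent (clamp a b l) (clamp a b ((l + r) / 2)) (clamp a b r) (clamp a b x) := by
  rw [covariance_comm, hP.covariance_secDiff_left hab _ _ (hP.memLp_IccExtend hab x)]
  simp only [hP.covariance_IccExtend hab, tent, min_comm (clamp a b x)]
  ring

theorem IsPrior.covariance_secDiff (l r l' r' : ℝ) :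
    cov[fun f : C(Icc a b, ℝ) => secDiff (IccExtend hab.le f) l r,
      fun f => secDiff (IccExtend hab.le f) l' r'; P] =
      lam * (2 * tent (clamp a b l') (clamp a b ((l' + r') / 2)) (clamp a b r')
          (clamp a b ((l + r) / 2)) -
        tent (clamp a b l') (clamp a b ((l' + r') / 2)) (clamp a b r') (clamp a b l) -
        tent (clamp a b l') (clamp a b ((l' + r') / 2)) (clamp a b r') (clamp a b r)) := by
  rw [hP.covariance_secDiff_left hab _ _ (hP.memLp_secDiff hab _ _)]
  simp only [hP.covariance_IccExtend_secDiff hab]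
  ring

include hm

/-- Haar orthogonality: the tent of the cell that is not larger vanishes at both ends and at the
midpoint of the other cell. -/
theorem IsPrior.covariance_haar_of_le {q q' j j' : ℕ} (hq : q ≤ q')
    (hne : (q, j) ≠ (q', j')) :
    cov[fun f : C(Icc a b, ℝ) => haar m a b (IccExtend hab.le f) q j,
      fun f => haar m a b (IccExtend hab.le f) q' j'; P] = 0 := by
  have key : ∀ s, 2 * j ≤ s → s ≤ 2 * j + 2 →
      tent (clamp a b (gridPt m a b q' j')) (clamp a b (gridPt m a b (q' + 1) (2 * j' + 1)))
        (clamp a b (gridPt m a b q' (j' + 1))) (clamp a b (gridPt m a b (q + 1) s)) = 0 := by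
    intro s h1 h2
    obtain ⟨h3, h4⟩ := midpoint_mem_cell (m := m) hab.le q' j'
    exact tent_eq_zero (clamp_mono a b h3) (clamp_mono a b h4) (clamp_cell hm hab.le q' j')
      ((gridPt_not_interior m hab.le hq hne h1 h2).imp (fun h => clamp_mono a b h)
        (fun h => clamp_mono a b h))
  -- Indices `j * 2 ^ 1` and `(j + 1) * 2 ^ 1` put the end points in the form expected by
  -- `gridPt_refine`.
  have k0 := key (j * 2 ^ 1) (by omega) (by omega)
  have k1 := key (2 * j + 1) (by omega) (by omega)
  have k2 := key ((j + 1) * 2 ^ 1) (by omega) (by omega)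
  rw [gridPt_refine] at k0 k2
  simp only [haar]
  rw [hP.covariance_secDiff hab, gridPt_midpoint, gridPt_midpoint, k0, k1, k2]
  ring

theorem IsPrior.covariance_haar {q q' j j' : ℕ} (hne : (q, j) ≠ (q', j')) :
    cov[fun f : C(Icc a b, ℝ) => haar m a b (IccExtend hab.le f) q j,
      fun f => haar m a b (IccExtend hab.le f) q' j'; P] = 0 := by
  rcases le_total q q' with h | h
  · exact hP.covariance_haar_of_le hab m hm h hne
  · rw [covariance_comm]
    exact hP.covariance_haar_of_le hab m hm h hne.symm

/-- Only the midpoint contributes: the tent has height half the cell width there, and the second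
difference doubles it. -/
theorem IsPrior.covariance_haar_self {q j : ℕ} (hj : j < m * 2 ^ q) :
    cov[fun f : C(Icc a b, ℝ) => haar m a b (IccExtend hab.le f) q j,
      fun f => haar m a b (IccExtend hab.le f) q j; P] = lam * ((b - a) / (m * 2 ^ q)) := by
  obtain ⟨h1, h2⟩ := midpoint_mem_cell (m := m) hab.le q j
  have ha := left_le_gridPt m hab.le q j
  have hb : gridPt m a b q (j + 1) ≤ b := by
    simpa [gridPt_last hm] using gridPt_mono m hab.le q (Nat.succ_le_of_lt hj)
  have hr : gridPt m a b q (j + 1) = gridPt m a b q j + (b - a) / (m * 2 ^ q) := by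
    simp only [gridPt]; push_cast; ring
  have hmid := gridPt_midpoint m a b q j
  have hc := clamp_cell hm hab.le q j
  simp only [haar]
  rw [hP.covariance_secDiff hab, gridPt_midpoint,
    tent_eq_zero (clamp_mono a b h1) (clamp_mono a b h2) hc (Or.inl le_rfl),
    tent_eq_zero (clamp_mono a b h1) (clamp_mono a b h2) hc (Or.inr le_rfl),
    clamp_of_mem ha (h1.trans (h2.trans hb)), clamp_of_mem (ha.trans (h1.trans h2)) hb,
    clamp_of_mem (ha.trans h1) (h2.trans hb), tent, min_self, min_eq_right h1, min_eq_left h2,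
    ← hmid, hr]
  ring

omit hm

theorem IsPrior.memLp_haar (q j : ℕ) :
    MemLp (fun f : C(Icc a b, ℝ) => haar m a b (IccExtend hab.le f) q j) 2 P :=
  hP.memLp_secDiff hab _ _

theorem IsPrior.integral_haar (q j : ℕ) :
    ∫ f : C(Icc a b, ℝ), haar m a b (IccExtend hab.le f) q j ∂P = 0 := by
  have := hP.isProbabilityMeasure
  have h : ∀ x, Integrable (fun f : C(Icc a b, ℝ) => IccExtend hab.le f x) P := fun x =>
    (hP.memLp_IccExtend hab x).integrable (by norm_num)
  have h2 : ∀ x y, Integrable (fun f : C(Icc a b, ℝ) =>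
      2 * IccExtend hab.le f x - IccExtend hab.le f y) P := fun x y =>
    ((h x).const_mul 2).sub (h y)
  simp only [haar, secDiff]
  rw [integral_sub (h2 _ _) (h _), integral_sub ((h _).const_mul 2) (h _), integral_const_mul]
  simp only [hP.integral_IccExtend hab]
  ring

theorem IsPrior.isGaussianProcess_haar :
    IsGaussianProcess (fun (s : ℕ × ℕ) (f : C(Icc a b, ℝ)) =>
      haar m a b (IccExtend hab.le f) s.1 s.2) P := by
  classical
  refine (hP.isGaussianProcess_IccExtend hab).of_linear_restrict fun s => ?_
  set l := gridPt m a b s.1 s.2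
  set r := gridPt m a b s.1 (s.2 + 1)
  exact ⟨{(l + r) / 2, l, r},
    { toFun x := 2 * x ⟨(l + r) / 2, by simp⟩ - x ⟨l, by simp⟩ - x ⟨r, by simp⟩
      map_add' x y := by simp only [Pi.add_apply]; ring
      map_smul' c x := by simp only [Pi.smul_apply, smul_eq_mul, RingHom.id_apply]; ring },
    fun f => rfl⟩

include hm

theorem IsPrior.isGaussianProcess_errEst :
    IsGaussianProcess (fun (u : ℕ × ℕ) (f : C(Icc a b, ℝ)) =>
      errEst m (IccExtend hab.le f) (left 2 a b u) (right 2 a b u)) P := by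
  classical
  refine (hP.isGaussianProcess_haar hab m).of_linear_restrict fun u => ?_
  refine ⟨(Finset.range m).image (fun i => (u.2, m * u.1 + i)),
    { toFun x := (b - a) / (4 * m * 2 ^ u.2) * ∑ i ∈ (Finset.range m).attach,
        x ⟨(u.2, m * u.1 + i), Finset.mem_image_of_mem _ i.2⟩
      map_add' x y := by simp only [Pi.add_apply, Finset.sum_add_distrib]; ring
      map_smul' c x := by
        simp only [Pi.smul_apply, smul_eq_mul, RingHom.id_apply, ← Finset.mul_sum]; ring },
    fun f => ?_⟩
  rw [errEst_node m hm, ← Finset.sum_attach]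
  rfl

theorem IsPrior.covariance_errEst (u v : ℕ × ℕ) :
    cov[fun f : C(Icc a b, ℝ) => errEst m (IccExtend hab.le f) (left 2 a b u) (right 2 a b u),
      fun f => errEst m (IccExtend hab.le f) (left 2 a b v) (right 2 a b v); P] =
      (b - a) / (4 * m * 2 ^ u.2) * ((b - a) / (4 * m * 2 ^ v.2) *
        ∑ i ∈ Finset.range m, ∑ j ∈ Finset.range m,
          cov[fun f : C(Icc a b, ℝ) => haar m a b (IccExtend hab.le f) u.2 (m * u.1 + i),
            fun f => haar m a b (IccExtend hab.le f) v.2 (m * v.1 + j); P]) := by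
  have := hP.isProbabilityMeasure
  simp only [errEst_node m hm]
  rw [covariance_const_mul_left, covariance_const_mul_right, covariance_fun_sum_fun_sum'
    (fun i _ => hP.memLp_haar hab m _ _) (fun i _ => hP.memLp_haar hab m _ _)]

/-- Distinct nodes share no cell: the depth and the quotient of the cell index by `m` recover the
node. -/
theorem IsPrior.covariance_errEst_of_ne {u v : ℕ × ℕ} (h : u ≠ v) :
    cov[fun f : C(Icc a b, ℝ) => errEst m (IccExtend hab.le f) (left 2 a b u) (right 2 a b u),
      fun f => errEst m (IccExtend hab.le f) (left 2 a b v) (right 2 a b v); P] = 0 := by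
  rw [hP.covariance_errEst hab m hm, Finset.sum_eq_zero, mul_zero, mul_zero]
  intro i hi
  refine Finset.sum_eq_zero fun j hj => hP.covariance_haar hab m hm fun he => h ?_
  rw [Finset.mem_range] at hi hj
  rw [Prod.mk.injEq] at he
  refine Prod.ext ?_ he.1
  have h1 : (m * u.1 + i) / m = u.1 := by
    rw [Nat.mul_add_div hm, Nat.div_eq_of_lt hi, add_zero]
  have h2 : (m * v.1 + j) / m = v.1 := by
    rw [Nat.mul_add_div hm, Nat.div_eq_of_lt hj, add_zero]
  rw [← h1, ← h2, he.2]

/-- The `m` cells are uncorrelated, so their variances add. The factor `8 ^ u.2` is `4 ^ u.2` from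
the squared prefactor times `2 ^ u.2` from the cell width. -/
theorem IsPrior.variance_errEst {u : ℕ × ℕ} (hu : u.1 < 2 ^ u.2) :
    Var[fun f : C(Icc a b, ℝ) =>
      errEst m (IccExtend hab.le f) (left 2 a b u) (right 2 a b u); P] =
      lam * (b - a) ^ 3 / (16 * m ^ 2 * 8 ^ u.2) := by
  have hm0 : (m : ℝ) ≠ 0 := by positivity
  rw [← covariance_self ((hP.isGaussianProcess_errEst hab m hm).aemeasurable u),
    hP.covariance_errEst hab m hm]
  have h : ∀ i ∈ Finset.range m, ∑ j ∈ Finset.range m,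
      cov[fun f : C(Icc a b, ℝ) => haar m a b (IccExtend hab.le f) u.2 (m * u.1 + i),
        fun f => haar m a b (IccExtend hab.le f) u.2 (m * u.1 + j); P] =
      lam * ((b - a) / (m * 2 ^ u.2)) := by
    intro i hi
    rw [Finset.sum_eq_single_of_mem i hi, hP.covariance_haar_self hab m hm]
    · rw [Finset.mem_range] at hi
      calc m * u.1 + i < m * (u.1 + 1) := by rw [mul_add_one]; omega
        _ ≤ m * 2 ^ u.2 := Nat.mul_le_mul_left _ hu
    · intro j _ hji
      refine hP.covariance_haar hab m hm fun he => hji ?_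
      rw [Prod.mk.injEq] at he
      omega
  rw [Finset.sum_congr rfl h, Finset.sum_const, Finset.card_range, nsmul_eq_mul,
    show (8 : ℝ) = 2 * 2 * 2 by norm_num, mul_pow, mul_pow]
  field_simp
  ring

theorem IsPrior.integral_errEst (u : ℕ × ℕ) :
    ∫ f : C(Icc a b, ℝ),
      errEst m (IccExtend hab.le f) (left 2 a b u) (right 2 a b u) ∂P = 0 := by
  have := hP.isProbabilityMeasure
  simp only [errEst_node m hm]
  rw [integral_const_mul, integral_finsetSum _ fun i _ =>
    (hP.memLp_haar hab m _ _).integrable (by norm_num)]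
  simp only [hP.integral_haar hab m, Finset.sum_const_zero, mul_zero]

theorem IsPrior.map_errEst {u : ℕ × ℕ} (hu : u.1 < 2 ^ u.2) :
    P.map (fun f : C(Icc a b, ℝ) =>
      errEst m (IccExtend hab.le f) (left 2 a b u) (right 2 a b u)) =
      gaussianReal 0 (lam * (b - a) ^ 3 / (16 * m ^ 2 * 8 ^ u.2)).toNNReal := by
  rw [((hP.isGaussianProcess_errEst hab m hm).hasGaussianLaw_eval u).map_eq_gaussianReal,
    hP.integral_errEst hab m hm, hP.variance_errEst hab m hm hu]

variable [BorelSpace C(Icc a b, ℝ)]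

omit hP in
theorem measurable_errEst (u : ℕ × ℕ) : Measurable (fun f : C(Icc a b, ℝ) =>
    errEst m (IccExtend hab.le f) (left 2 a b u) (right 2 a b u)) := by
  have h : ∀ x, Measurable (fun f : C(Icc a b, ℝ) => IccExtend hab.le f x) := fun x =>
    (continuous_eval_const (projIcc a b hab.le x)).measurable
  simp only [errEst_node m hm, haar, secDiff]
  exact (Finset.measurable_fun_sum _ fun i _ =>
    (((h _).const_mul 2).sub (h _)).sub (h _)).const_mul _

theorem IsPrior.iIndepFun_errEst : iIndepFun (fun (u : ℕ × ℕ) (f : C(Icc a b, ℝ)) =>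
    errEst m (IccExtend hab.le f) (left 2 a b u) (right 2 a b u)) P := by
  -- Uncorrelated jointly Gaussian families are independent; each family here has one member,
  -- indexed by `Unit`.
  have h := IsGaussianProcess.iIndepFun_of_covariance_eq_zero (S := fun _ : ℕ × ℕ => Unit)
    (X := fun (u : ℕ × ℕ) (_ : Unit) (f : C(Icc a b, ℝ)) =>
      errEst m (IccExtend hab.le f) (left 2 a b u) (right 2 a b u))
    ((hP.isGaussianProcess_errEst hab m hm).comp_right Sigma.fst)
    (fun u _ => (measurable_errEst hab m hm u).aemeasurable)
    (fun u v huv _ _ => hP.covariance_errEst_of_ne hab m hm huv)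
  exact h.comp (fun _ x => x ()) fun _ => measurable_pi_apply _

omit hP in
theorem measurableSet_acceptSet (ρ τ : ℝ) (u : ℕ × ℕ) :
    MeasurableSet (acceptSet ρ m hab.le τ u) :=
  measurableSet_lt (measurable_errEst hab m hm u).abs measurable_const

theorem IsPrior.iIndepSet_acceptSet (ρ τ : ℝ) : iIndepSet (acceptSet ρ m hab.le τ) P := by
  have := hP.isProbabilityMeasure
  rw [iIndepSet_iff_meas_biInter (measurableSet_acceptSet hab m hm ρ τ)]
  intro s
  exact (hP.iIndepFun_errEst hab m hm).measure_inter_preimage_eq_mul s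
    (sets := fun u => {x : ℝ | |x| < τ * ρ ^ u.2})
    (fun u _ => measurableSet_lt measurable_id.abs measurable_const)

end Gaussian

/-! ### The standard normal law -/

section StandardNormal

/-- The probability that a standard normal variable is less than `c` in absolute value. -/
def normalAbsLt (c : ℝ) : ℝ := (gaussianReal 0 1).real {z : ℝ | |z| < c}

theorem normalAbsLt_nonneg (c : ℝ) : 0 ≤ normalAbsLt c := measureReal_nonneg

theorem normalAbsLt_mono : Monotone normalAbsLt := fun _ _ h =>
  measureReal_mono fun _ hz => lt_of_lt_of_le hz h

theorem measureReal_gaussianReal_Ioo_pos {x y : ℝ} (h : x < y) :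
    0 < (gaussianReal 0 1).real (Ioo x y) := by
  refine (measureReal_nonneg).lt_of_ne' fun h0 => ?_
  rw [measureReal_eq_zero_iff] at h0
  have := gaussianReal_absolutelyContinuous' 0 one_ne_zero h0
  simp only [Real.volume_Ioo, ENNReal.ofReal_eq_zero] at this
  linarith

/-- Adding the right-hand interval alone already suffices for strict monotonicity. -/
theorem normalAbsLt_add_Ioo_le {c d : ℝ} (hc : 0 ≤ c) :
    normalAbsLt c + (gaussianReal 0 1).real (Ioo c d) ≤ normalAbsLt (max c d) := by
  rw [normalAbsLt, ← measureReal_union _ measurableSet_Ioo]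
  · refine measureReal_mono ?_
    rintro z (hz | hz)
    · rw [mem_ofPred_eq] at hz ⊢
      exact hz.trans_le (le_max_left _ _)
    · rw [mem_ofPred_eq, abs_of_pos (hc.trans_lt hz.1)]
      exact hz.2.trans_le (le_max_right _ _)
  · rw [Set.disjoint_left]
    intro z hz hz'
    exact absurd ((le_abs_self z).trans_lt hz) (not_lt.2 hz'.1.le)

theorem normalAbsLt_strictMonoOn : StrictMonoOn normalAbsLt (Ici 0) := by
  intro c hc d _ hcd
  have h := normalAbsLt_add_Ioo_le (d := d) hc
  rw [max_eq_right hcd.le] at h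
  linarith [measureReal_gaussianReal_Ioo_pos hcd]

theorem normalAbsLt_lt_one {c : ℝ} (hc : 0 ≤ c) : normalAbsLt c < 1 :=
  (normalAbsLt_strictMonoOn hc (mem_Ici.2 (by linarith : (0 : ℝ) ≤ c + 1)) (lt_add_one c)).trans_le
    measureReal_le_one

/-- The infimum defining the quantile is attained, by right continuity of the distribution function;
`p < 1` makes the set nonempty. -/
theorem le_cdf_of_normalQuantile_le {p x : ℝ} (hp : p < 1) (h : normalQuantile p ≤ x) :
    p ≤ cdf (gaussianReal 0 1) x := by
  have hne : {x : ℝ | p ≤ cdf (gaussianReal 0 1) x}.Nonempty :=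
    (((tendsto_cdf_atTop (gaussianReal 0 1)).eventually (lt_mem_nhds hp)).exists).imp fun _ h => h.le
  have hgt : ∀ y ∈ Ioi x, p ≤ cdf (gaussianReal 0 1) y := by
    intro y hy
    obtain ⟨z, hz, hzy⟩ := exists_lt_of_csInf_lt hne (h.trans_lt hy)
    exact (mem_ofPred_eq ▸ hz).trans (monotone_cdf _ hzy.le)
  have hc := ((cdf (gaussianReal 0 1)).right_continuous x).tendsto.mono_left
    (nhdsWithin_mono x Ioi_subset_Ici_self)
  exact ge_of_tendsto hc (Filter.eventually_of_mem self_mem_nhdsWithin hgt)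

/-- The left tail has mass at least `1/4`, and by symmetry so has the right one. -/
theorem normalAbsLt_le_half {c : ℝ} (hc : 0 < c) (h : c ≤ -normalQuantile (1 / 4)) :
    normalAbsLt c ≤ 1 / 2 := by
  have h1 : 1 / 4 ≤ (gaussianReal 0 1).real (Iic (-c)) := by
    rw [← cdf_eq_real]
    exact le_cdf_of_normalQuantile_le (by norm_num) (by linarith)
  have h2 : (gaussianReal 0 1).real (Ici c) = (gaussianReal 0 1).real (Iic (-c)) := by
    -- Writing the mean as `-0` exposes the law as its own image under negation.
    conv_lhs => rw [← neg_zero (G := ℝ), ← gaussianReal_map_neg]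
    rw [map_measureReal_apply measurable_neg measurableSet_Ici]
    congr 1
    ext z
    simp only [mem_preimage, mem_Ici, mem_Iic]
    exact le_neg
  have h3 : {z : ℝ | |z| < c} = (Iic (-c) ∪ Ici c)ᶜ := by
    ext z
    simp only [mem_ofPred_eq, mem_compl_iff, mem_union, mem_Iic, mem_Ici, not_or, not_le, abs_lt]
  rw [normalAbsLt, h3, probReal_compl_eq_one_sub (measurableSet_Iic.union measurableSet_Ici),
    measureReal_union _ measurableSet_Ici, h2]
  · linarith
  · rw [Set.disjoint_left]
    intro z hz hz'
    simp only [mem_Iic, mem_Ici] at hz hz'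
    linarith

theorem measurableSet_abs_lt (t : ℝ) : MeasurableSet {x : ℝ | |x| < t} :=
  measurableSet_lt measurable_id.abs measurable_const

theorem measureReal_gaussianReal_abs_lt {κ t : ℝ} (hκ : 0 < κ) :
    (gaussianReal 0 (κ ^ 2).toNNReal).real {x : ℝ | |x| < t} = normalAbsLt (t / κ) := by
  have h : gaussianReal 0 (κ ^ 2).toNNReal = (gaussianReal 0 1).map (κ * ·) := by
    rw [gaussianReal_map_const_mul, mul_zero, mul_one]
    congr 1
    exact Real.toNNReal_of_nonneg (sq_nonneg κ)
  rw [h, map_measureReal_apply (measurable_const_mul κ)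
    (measurableSet_abs_lt t), normalAbsLt]
  congr 1
  ext z
  simp only [mem_preimage, mem_ofPred_eq, abs_mul, abs_of_pos hκ, lt_div_iff₀ hκ, mul_comm κ]

end StandardNormal

theorem two_rpow_three_halves_sq : ((2 : ℝ) ^ (3 / 2 : ℝ)) ^ 2 = 8 := by
  rw [← Real.rpow_natCast, ← Real.rpow_mul (by norm_num)]
  norm_num

/-! ### Acceptance probabilities and the main theorem -/

section Main

variable {a b : ℝ} (hab : a < b) [MeasurableSpace C(Icc a b, ℝ)] [BorelSpace C(Icc a b, ℝ)]
  {lam γ : ℝ} {P : Measure C(Icc a b, ℝ)}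

/-- The tolerance `τ * ρ ^ q` is divided by the standard deviation, which carries the factor `(2 ^
(3/2)) ^ (-q)`. -/
theorem IsPrior.measureReal_acceptSet (hlam : 0 < lam) (hP : IsPrior lam γ P) {m : ℕ} (hm : 0 < m)
    (ρ τ : ℝ) {u : ℕ × ℕ} (hu : u.1 < 2 ^ u.2) :
    P.real (acceptSet ρ m hab.le τ u) =
      normalAbsLt (4 * m * τ / √(lam * (b - a) ^ 3) * (ρ * (2 : ℝ) ^ (3 / 2 : ℝ)) ^ u.2) := by
  set s : ℝ := (2 : ℝ) ^ (3 / 2 : ℝ) with hs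
  have hs0 : 0 < s := by positivity
  have hba : 0 < b - a := sub_pos.2 hab
  set r := √(lam * (b - a) ^ 3) with hr
  have hr0 : 0 < r := Real.sqrt_pos.2 (by positivity)
  have hr2 : r ^ 2 = lam * (b - a) ^ 3 := Real.sq_sqrt (by positivity)
  have hm0 : (0 : ℝ) < m := by positivity
  have hvar : lam * (b - a) ^ 3 / (16 * m ^ 2 * 8 ^ u.2) = (r / (4 * m * s ^ u.2)) ^ 2 := by
    rw [div_pow, mul_pow, ← pow_mul, mul_comm u.2, pow_mul, two_rpow_three_halves_sq, hr2]
    ring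
  have h := map_measureReal_apply (μ := P) (measurable_errEst hab m hm u)
    (measurableSet_abs_lt (τ * ρ ^ u.2))
  rw [hP.map_errEst hab m hm hu, hvar, measureReal_gaussianReal_abs_lt (by positivity)] at h
  refine h.symm.trans (congrArg _ ?_)
  rw [mul_pow]
  field_simp

theorem IsPrior.tendsto_extinctProb (hlam : 0 < lam) (hP : IsPrior lam γ P) {m : ℕ} (hm : 0 < m)
    (ρ τ : ℝ) :
    Filter.Tendsto (fun n => extinctProb (fun q =>
        normalAbsLt (4 * m * τ / √(lam * (b - a) ^ 3) * (ρ * (2 : ℝ) ^ (3 / 2 : ℝ)) ^ q)) n 0)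
      Filter.atTop (nhds (1 - P.real {f | tree ρ m 2 hab.le τ f ∈ infiniteTrees 2})) := by
  have := hP.isProbabilityMeasure
  rw [setOf_tree_mem_infiniteTrees]
  exact AdapTrap.tendsto_extinctProb (measurableSet_acceptSet hab m hm ρ τ)
    (hP.iIndepSet_acceptSet hab m hm ρ τ) fun u hu => hP.measureReal_acceptSet hab hlam hm ρ τ hu

end Main

end AdapTrap

end

theorem mainTheorem3 (a b : ℝ) (hab : a < b)
    [MeasurableSpace C(Set.Icc a b, ℝ)] [BorelSpace C(Set.Icc a b, ℝ)]
    (lam γ : ℝ) (hlam : 0 < lam)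
    (P : MeasureTheory.Measure C(Set.Icc a b, ℝ)) (hP : AdapTrap.IsPrior lam γ P)
    (m : ℕ) (hm : 0 < m) (τ : ℝ) (hτ : 0 < τ) :
    (τ ≤ -AdapTrap.normalQuantile (1 / (2 * 2)) * √(lam * (b - a) ^ 3) / (4 * m) →
      P.real {f | AdapTrap.tree (1 / (2 : ℝ) ^ (3 / 2 : ℝ)) m 2 hab.le τ f
          ∈ AdapTrap.infiniteTrees 2}
        = (1 - 2 * AdapTrap.acceptProb m lam a b τ) / (1 - AdapTrap.acceptProb m lam a b τ)) ∧
    (∀ ρ : ℝ, 0 < ρ → ρ < 1 / (2 : ℝ) ^ (3 / 2 : ℝ) →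
      P.real {f | AdapTrap.tree ρ m 2 hab.le τ f ∈ AdapTrap.infiniteTrees 2}
        > (1 - 2 * AdapTrap.acceptProb m lam a b τ) / (1 - AdapTrap.acceptProb m lam a b τ)) := by
  have hba : 0 < b - a := sub_pos.2 hab
  have hr0 : 0 < √(lam * (b - a) ^ 3) := Real.sqrt_pos.2 (by positivity)
  have hm0 : (0 : ℝ) < m := by positivity
  set c := 4 * m * τ / √(lam * (b - a) ^ 3) with hc
  have hc0 : 0 < c := by positivity
  have hα : AdapTrap.acceptProb m lam a b τ = AdapTrap.normalAbsLt c := rfl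
  rw [hα]
  have hα1 := AdapTrap.normalAbsLt_lt_one hc0.le
  have hs0 : (0 : ℝ) < (2 : ℝ) ^ (3 / 2 : ℝ) := by positivity
  have hfrac : (1 - 2 * AdapTrap.normalAbsLt c) / (1 - AdapTrap.normalAbsLt c) =
      1 - AdapTrap.normalAbsLt c / (1 - AdapTrap.normalAbsLt c) := by
    have : 1 - AdapTrap.normalAbsLt c ≠ 0 := by linarith
    field_simp
    ring
  rw [hfrac]
  constructor
  · intro hle
    have hhalf : AdapTrap.normalAbsLt c ≤ 1 / 2 := by
      refine AdapTrap.normalAbsLt_le_half hc0 ?_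
      rw [hc, div_le_iff₀ hr0]
      rw [le_div_iff₀ (by positivity)] at hle
      norm_num at hle ⊢
      linarith
    have h := hP.tendsto_extinctProb hab hlam hm (1 / (2 : ℝ) ^ (3 / 2 : ℝ)) τ
    -- At the critical `ρ` the per-level ratio is `1`, so all generations share one acceptance
    -- probability.
    simp only [one_div_mul_cancel hs0.ne', one_pow, mul_one] at h
    have := AdapTrap.eq_of_tendsto_extinctProb_const (AdapTrap.normalAbsLt_nonneg c) hhalf h
    linarith
  · intro ρ hρ hρlt
    rw [lt_div_iff₀ hs0] at hρlt
    have hκ0 : 0 < ρ * (2 : ℝ) ^ (3 / 2 : ℝ) := by positivity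
    rcases le_or_gt (AdapTrap.normalAbsLt c) (1 / 2) with hhalf | hhalf
    · have := AdapTrap.lt_of_tendsto_extinctProb
        (fun q => AdapTrap.normalAbsLt_nonneg _)
        (fun i j hij => AdapTrap.normalAbsLt_mono (mul_le_mul_of_nonneg_left
          (pow_le_pow_of_le_one hκ0.le hρlt.le hij) hc0.le))
        (AdapTrap.normalAbsLt_strictMonoOn (Set.mem_Ici.2 (by positivity))
          (Set.mem_Ici.2 (by positivity)) (by
            rw [pow_one, pow_zero]; exact mul_lt_mul_of_pos_left hρlt hc0))
        (by rwa [pow_zero, mul_one])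
        (hP.tendsto_extinctProb hab hlam hm ρ τ)
      rw [pow_zero, mul_one] at this
      linarith
    -- Here the right-hand side is negative, so nonnegativity of the measure suffices.
    · have h1 : 1 < AdapTrap.normalAbsLt c / (1 - AdapTrap.normalAbsLt c) := by
        rw [lt_div_iff₀ (by linarith)]; linarith
      have h2 : 0 ≤ P.real {f | AdapTrap.tree ρ m 2 hab.le τ f ∈ AdapTrap.infiniteTrees 2} :=
        MeasureTheory.measureReal_nonneg
      linarith
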